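/- Let $0\le\beta<1$ and $\gamma>0$. On a finite tree $T=(V,E)$ with root $r$, a configuration $\xi:V\to\{0,1\}$ (state $0$ is blue, state $1$ is green) has Gibbs probability proportional to $\prod_{uv\in E}A_{\xi(u),\xi(v)}$, where $A=\begin{pmatrix}\beta&1\\1&\gamma\end{pmatrix}$. For $\Lambda\subseteq V$ and a partial configuration $\sigma_\Lambda\in\{0,1\}^\Lambda$ of positive Gibbs probability, let $p$ be the probability that $r$ is blue, conditioned on $\sigma_\Lambda$, and let $R_T^{\sigma_\Lambda}=p/(1-p)\in[0,\infty]$ (with value $\infty$ if $p=1$, and with the convention $|\infty-\infty|=0$). For an integer $M\ge2$, the $M$-based depth is defined by $L_M(r)=0$ and $L_M(u)=L_M(v)+\lceil\log_M(d+1)\rceil$ whenever $u$ is a child of a vertex $v$ that has $d$ children. Let $B_M(L)=\{v: L_M(v)\le L\}$, and let $B_M^*(L)$ consist of the vertices of $B_M(L)$ and all their children. For $1\le\gamma$ with $\beta\gamma<1$ and real $d\ge1$, let $x(\gamma,d)$ be the unique positive solution of $x=\left(\frac{\beta x+1}{x+\gamma}\right)^d$, and let \[\Gamma(\beta)=\inf\left\{\gamma\ge1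 \;\middle|\; \beta\gamma<1 \text{ and } \frac{d(1-\beta\gamma)(\beta x(\gamma,d)+1)^{d-1}}{(x(\gamma,d)+\gamma)^{d+1}}\le1\ \text{ for all real } d\ge1\right\}.\] **Theorem (Computationally efficient correlation decay).** Let $0\le\beta<1$, $\beta\gamma<1$ and $\gamma>\Gamma(\beta)$. There are an integer $M\ge2$ and a real $c>0$, depending only on $\beta$ and $\gamma$, such that for every finite rooted tree $T$, every set $\Lambda$ of vertices, any two partial configurations $\sigma_\Lambda,\tau_\Lambda\in\{0,1\}^\Lambda$ of positive Gibbs probability, with $\Delta=\{v\in\Lambda:\sigma_\Lambda(v)\ne\tau_\Lambda(v)\}$, and every integer $L\ge0$: if $B_M^*(L)\cap\Delta=\emptyset$, then \[\left|R_T^{\sigma_\Lambda}-R_T^{\tau_\Lambda}\right|\le\exp(-cL).\] -/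

import Mathlib

open scoped ENNReal

noncomputable section

namespace TwoSpin

/-! ## Two-state spin systems on a finite graph -/

/-- The interaction matrix. State `0` is blue and state `1` is green. -/
def interaction (β γ : ℝ) : Matrix (Fin 2) (Fin 2) ℝ := !![β, 1; 1, γ]

theorem interaction_symm (β γ : ℝ) (i j : Fin 2) :
    interaction β γ i j = interaction β γ j i := by
  fin_cases i <;> fin_cases j <;> simp [interaction]

/-- The contribution `A (σ u) (σ v)` of the edge `uv` under the configuration `σ`. -/
def edgeWeight {V : Type*} (β γ : ℝ) (σ : V → Fin 2) : Sym2 V → ℝ :=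
  Sym2.lift ⟨fun u v => interaction β γ (σ u) (σ v), fun _ _ => interaction_symm β γ _ _⟩

open Classical in
/-- The weight of a configuration: the product of the contributions of all edges. -/
def weight {V : Type*} [Fintype V] (β γ : ℝ) (G : SimpleGraph V) (σ : V → Fin 2) : ℝ :=
  ∏ e ∈ G.edgeFinset, edgeWeight β γ σ e

open Classical in
/-- The partition function. -/
def partitionFunction {V : Type*} [Fintype V] (β γ : ℝ) (G : SimpleGraph V) : ℝ :=
  ∑ σ : V → Fin 2, weight β γ G σ

/-- The Gibbs measure (as a probability mass on configurations). -/
def gibbs {V : Type*} [Fintype V] (β γ : ℝ) (G : SimpleGraph V) (σ : V → Fin 2) : ℝ :=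
  weight β γ G σ / partitionFunction β γ G

open Classical in
/-- The Gibbs probability of an event. -/
def gibbsProb {V : Type*} [Fintype V] (β γ : ℝ) (G : SimpleGraph V)
    (E : Set (V → Fin 2)) : ℝ :=
  ∑ σ : V → Fin 2, if σ ∈ E then gibbs β γ G σ else 0

/-- The event that the configuration on `Λ` is the given partial configuration. -/
def extending {V : Type*} (Λ : Set V) (σ : Λ → Fin 2) : Set (V → Fin 2) :=
  {ξ | ∀ v : Λ, ξ v = σ v}

/-- The partial configuration occurs with positive Gibbs probability, so that one can condition
on it. -/
def Feasible {V : Type*} [Fintype V] (β γ : ℝ) (G : SimpleGraph V) (Λ : Set V)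
    (σ : Λ → Fin 2) : Prop :=
  0 < gibbsProb β γ G (extending Λ σ)

/-- The marginal probability that `v` is blue, conditioned on the partial configuration. -/
def marginal {V : Type*} [Fintype V] (β γ : ℝ) (G : SimpleGraph V) (Λ : Set V)
    (σ : Λ → Fin 2) (v : V) : ℝ :=
  gibbsProb β γ G (extending Λ σ ∩ {ξ | ξ v = 0}) / gibbsProb β γ G (extending Λ σ)

/-- The ratio `p / (1 - p)` of the conditional probabilities that `v` is blue and green;
it is `∞` when `p = 1`. -/
def ratio {V : Type*} [Fintype V] (β γ : ℝ) (G : SimpleGraph V) (Λ : Set V)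
    (σ : Λ → Fin 2) (v : V) : ℝ≥0∞ :=
  ENNReal.ofReal (marginal β γ G Λ σ v) / ENNReal.ofReal (1 - marginal β γ G Λ σ v)

/-- The absolute difference of two extended nonnegative reals, with `|∞ - ∞| = 0` and
`|∞ - a| = ∞` for finite `a`. -/
def absDiff (a b : ℝ≥0∞) : ℝ≥0∞ := max (a - b) (b - a)

/-- The set of vertices of `Λ` on which two partial configurations differ. -/
def differenceSet {V : Type*} (Λ : Set V) (σ τ : Λ → Fin 2) : Set V :=
  {v | ∃ h : v ∈ Λ, σ ⟨v, h⟩ ≠ τ ⟨v, h⟩}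

/-! ## The refined metric on a rooted tree -/

/-- In the tree `T` rooted at `r`, the vertex `u` is a child of `v`. -/
def IsChild {V : Type*} (T : SimpleGraph V) (r v u : V) : Prop :=
  T.Adj v u ∧ T.dist r u = T.dist r v + 1

/-- The number of children of `v`. -/
def numChildren {V : Type*} (T : SimpleGraph V) (r v : V) : ℕ := {u | IsChild T r v u}.ncard

open Classical in
/-- The `M`-based depth: `0` at the root, and for a child of a vertex `v` with `d` children,
the depth of `v` plus `⌈log_M (d + 1)⌉`. -/
def mDepth {V : Type*} (T : SimpleGraph V) (r : V) (M : ℕ) (u : V) : ℕ :=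
  if h : ∃ v, IsChild T r v u then
    mDepth T r M h.choose + Nat.clog M (numChildren T r h.choose + 1)
  else 0
termination_by T.dist r u
decreasing_by
  have := h.choose_spec.2
  omega

/-- The `M`-based `L`-ball. -/
def mBall {V : Type*} (T : SimpleGraph V) (r : V) (M L : ℕ) : Set V := {v | mDepth T r M v ≤ L}

/-- The `M`-based `L`-closed-ball: the vertices of the `L`-ball together with their children. -/
def mClosedBall {V : Type*} (T : SimpleGraph V) (r : V) (M L : ℕ) : Set V :=
  mBall T r M L ∪ {u | ∃ v ∈ mBall T r M L, IsChild T r v u}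

/-! The two clauses of the recursion that defines the `M`-based depth. -/

theorem mDepth_root {V : Type*} (T : SimpleGraph V) (r : V) (M : ℕ) : mDepth T r M r = 0 := by
  rw [mDepth, dif_neg]
  rintro ⟨v, -, h⟩
  simp at h

theorem IsChild.parent_unique {V : Type*} {T : SimpleGraph V} (hT : T.IsTree) {r v w u : V}
    (hv : IsChild T r v u) (hw : IsChild T r w u) : v = w := by
  obtain ⟨p, hp⟩ := hT.connected.exists_walk_length_eq_dist r v
  obtain ⟨q, hq⟩ := hT.connected.exists_walk_length_eq_dist r w
  have hp' : (p.concat hv.1).IsPath :=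
    SimpleGraph.Walk.isPath_of_length_eq_dist _ (by simp [hp, hv.2])
  have hq' : (q.concat hw.1).IsPath :=
    SimpleGraph.Walk.isPath_of_length_eq_dist _ (by simp [hq, hw.2])
  have h := (hT.existsUnique_path r u).unique hp' hq'
  simpa using congrArg SimpleGraph.Walk.penultimate h

theorem mDepth_child {V : Type*} {T : SimpleGraph V} (hT : T.IsTree) {r v u : V} (M : ℕ)
    (h : IsChild T r v u) :
    mDepth T r M u = mDepth T r M v + Nat.clog M (numChildren T r v + 1) := by
  have h' : ∃ v, IsChild T r v u := ⟨v, h⟩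
  rw [mDepth, dif_pos h', h'.choose_spec.parent_unique hT h]

/-! ## The uniqueness threshold -/

/-- The uniqueness threshold `Γ(β)`: the infimum of those `γ ∈ [1, 1/β)` for which, for every
real `d ≥ 1`, the (unique) positive fixed point `x` of `f(x) = ((β x + 1) / (x + γ)) ^ d`
satisfies `|f'(x)| ≤ 1`. -/
def uniquenessThreshold (β : ℝ) : ℝ :=
  sInf {γ : ℝ | 1 ≤ γ ∧ β * γ < 1 ∧ ∀ d : ℝ, 1 ≤ d → ∀ x : ℝ, 0 < x →
    x = ((β * x + 1) / (x + γ)) ^ d →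
    d * (1 - β * γ) * (β * x + 1) ^ (d - 1) / (x + γ) ^ (d + 1) ≤ 1}

end TwoSpin

end

/-!
Write `h x = (β x + 1) / (x + γ)`. On a tree, the ratio of a free vertex is the product of `h` over
the ratios of its children. The proof measures the distance of two ratios in the coordinate
`log (-log x)`. With `u = -log x`, the recursion reads `u = ∑ H (u_i)` with `H (u) = -log h(e⁻ᵘ)`:
products have become sums of positive terms, and such a sum changes by a factor of at most `e^B` if
every term does. So it suffices that `H` contracts the metric `|log u - log u'|`, and no
symmetrization over the children is needed (`logLogClose_edgeFactor_prod`).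

The logarithmic derivative of `H` in `log u` is `(1 - β γ) x u / ((β x + 1) (x + γ) H)` up to sign.
The point of the coordinate is that this is the derivative of the univariate recursion at its fixed
point `x`, for the real degree `d = log x / log (h x)`. Hence the uniqueness condition at some
`γ' < γ` bounds it by `1` if `d ≥ 1`, and the bound is elementary if `d < 1`. For fixed `x` the
derivative decreases in `γ`, so it is at most some `ρ < 1` at `γ`, uniformly in `x`
(`exists_contraction_bound`). Moreover, a free vertex with `d` children has `u ≥ d log γ`, where the
derivative is of order `u e⁻ᵘ`, so the contraction factor at such a vertex is even at most
`e^(-c d)` (`exists_contraction_rate`). This pays for the step `⌈log₂ (d + 1)⌉ ≤ d` of the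
`2`-based depth, and induction from the leaves gives `logLogClose_childFactor`. The constant factor
of this decay is removed by the trivial bound `1 / γ` on the ratio of a free root with children.

The tree recursion itself is obtained by summing out the vertices of the Gibbs weight one at a
time, starting from the leaves (`sum_weight_root_eq_message`).
-/

namespace TwoSpin

/-! ### The uniqueness threshold -/

theorem threshold_derivative_eq {A B x d : ℝ} (c : ℝ) (hA : 0 < A) (hB : 0 < B)
    (h : x = (A / B) ^ d) :
    d * c * A ^ (d - 1) / B ^ (d + 1) = d * c * x / (A * B) := by
  have hBd : 0 < B ^ d := Real.rpow_pos_of_pos hB d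
  rw [h, Real.div_rpow hA.le hB.le, Real.rpow_sub_one hA.ne', Real.rpow_add_one hB.ne']
  field_simp

/-- The uniqueness condition holds at some `γ`, so the infimum defining the threshold is not the
junk value `sInf ∅ = 0`. -/
theorem uniquenessThreshold_set_nonempty {β : ℝ} (hβ0 : 0 ≤ β) (hβ1 : β < 1) :
    {γ : ℝ | 1 ≤ γ ∧ β * γ < 1 ∧ ∀ d : ℝ, 1 ≤ d → ∀ x : ℝ, 0 < x →
      x = ((β * x + 1) / (x + γ)) ^ d →
      d * (1 - β * γ) * (β * x + 1) ^ (d - 1) / (x + γ) ^ (d + 1) ≤ 1}.Nonempty := by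
  -- It suffices that `1 - β γ ≤ log γ`, because `d x ≤ d γ ^ (-d) ≤ 1 / log γ`.
  obtain ⟨γ, h1, hβγ, hlog⟩ : ∃ γ : ℝ, 1 < γ ∧ β * γ < 1 ∧ 1 - β * γ ≤ Real.log γ := by
    rcases hβ0.eq_or_lt with rfl | hβ
    · exact ⟨Real.exp 1, Real.one_lt_exp_iff.2 one_pos, by simp, by simp⟩
    · -- For `γ = 1 / √β` one has `β γ = 1 / γ`, and `1 - 1 / γ ≤ log γ`.
      have hs : 0 < √β := Real.sqrt_pos.2 hβ
      have hs1 : √β < 1 := by rw [Real.sqrt_lt' one_pos]; simpa using hβ1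
      have e : β * (√β)⁻¹ = √β := by
        field_simp
        exact (Real.sq_sqrt hβ0).symm
      refine ⟨(√β)⁻¹, (one_lt_inv₀ hs).2 hs1, by rwa [e], ?_⟩
      have := Real.one_sub_inv_le_log_of_pos (inv_pos.2 hs)
      rwa [e, inv_inv] at *
  refine ⟨γ, h1.le, hβγ, fun d hd x hx hfix => ?_⟩
  have hA : 0 < β * x + 1 := by positivity
  have hB : 0 < x + γ := by linarith
  rw [threshold_derivative_eq _ hA hB hfix, div_le_one (by positivity)]
  have hlγ : 0 < Real.log γ := Real.log_pos h1
  have hle : (β * x + 1) / (x + γ) ≤ γ⁻¹ := by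
    rw [div_le_iff₀ hB, ← sub_nonneg]
    have : γ⁻¹ * (x + γ) - (β * x + 1) = x * (1 - β * γ) / γ := by field_simp; ring
    rw [this]
    exact div_nonneg (mul_nonneg hx.le (by linarith)) (by linarith)
  have hxd : x ≤ Real.exp (-(d * Real.log γ)) := by
    have h2 : x ≤ γ⁻¹ ^ d := by
      conv_lhs => rw [hfix]
      exact Real.rpow_le_rpow (by positivity) hle (by linarith)
    rw [Real.rpow_def_of_pos (by positivity), Real.log_inv] at h2
    convert h2 using 2
    ring
  have hdx : d * Real.log γ * x ≤ 1 := by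
    have h3 := Real.add_one_le_exp (d * Real.log γ)
    have h4 : Real.exp (-(d * Real.log γ)) * Real.exp (d * Real.log γ) = 1 := by
      rw [← Real.exp_add]; simp
    have h5 : 0 ≤ d * Real.log γ := by positivity
    calc d * Real.log γ * x ≤ Real.exp (d * Real.log γ) * Real.exp (-(d * Real.log γ)) := by
          gcongr; linarith
      _ = 1 := by rw [mul_comm, h4]
  calc d * (1 - β * γ) * x ≤ d * Real.log γ * x := by gcongr
    _ ≤ 1 := hdx
    _ ≤ (β * x + 1) * (x + γ) := by
      have : 0 ≤ β * x := by positivity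
      nlinarith

/-- Above the threshold, the one-step derivative is bounded by some `ρ < 1` in the coordinate
`log (-log x)`. At a fixed point, `d = log x / log ((β x + 1) / (x + γ))`, so the condition at a
parameter `γ' < γ` is the inequality with `γ'` in place of `γ` and `ρ = 1`; for fixed `x` the
inequality improves as `γ'` grows, uniformly in `x`. -/
theorem exists_contraction_bound {β γ : ℝ} (hβ0 : 0 ≤ β) (hβ1 : β < 1)
    (hγ : uniquenessThreshold β < γ) :
    1 < γ ∧ ∃ ρ : ℝ, 0 < ρ ∧ ρ < 1 ∧ ∀ x : ℝ, 0 < x → x < 1 →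
      (1 - β * γ) * (x * -Real.log x) ≤
        ρ * ((β * x + 1) * (x + γ) * Real.log ((x + γ) / (β * x + 1))) := by
  obtain ⟨g, ⟨hg1, hβg, hg⟩, hgγ⟩ :=
    exists_lt_of_csInf_lt (uniquenessThreshold_set_nonempty hβ0 hβ1) hγ
  refine ⟨by linarith, (1 + g) / (1 + γ), div_pos (by linarith) (by linarith),
    by rw [div_lt_one (by linarith)]; linarith, fun x hx hx1 => ?_⟩
  have hA : 0 < β * x + 1 := by positivity
  have hB : 0 < x + g := by linarith
  have hlx : 0 < -Real.log x := neg_pos.2 (Real.log_neg hx hx1)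
  have hlg : 0 < Real.log ((x + g) / (β * x + 1)) := by
    apply Real.log_pos
    rw [one_lt_div hA]
    nlinarith
  have key : (1 - β * g) * (x * -Real.log x) ≤
      (β * x + 1) * (x + g) * Real.log ((x + g) / (β * x + 1)) := by
    rcases le_or_gt (Real.log ((x + g) / (β * x + 1))) (-Real.log x) with h | h
    · set d := -Real.log x / Real.log ((x + g) / (β * x + 1)) with hd
      have hfix : x = ((β * x + 1) / (x + g)) ^ d := by
        rw [Real.rpow_def_of_pos (by positivity), ← inv_div (x + g) (β * x + 1), Real.log_inv, hd]
        rw [neg_mul, mul_div_cancel₀ _ hlg.ne', neg_neg, Real.exp_log hx]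
      have h1 := hg d ((one_le_div hlg).2 h) x hx hfix
      rw [threshold_derivative_eq _ hA hB hfix, div_le_one (by positivity)] at h1
      calc (1 - β * g) * (x * -Real.log x)
          = d * (1 - β * g) * x * Real.log ((x + g) / (β * x + 1)) := by
            rw [hd]; field_simp
        _ ≤ _ := by gcongr
    · -- Here the degree `d` is less than `1`, and the uniqueness condition is not available.
      have h2 : (1 - β * g) * x ≤ (β * x + 1) * (x + g) := by
        nlinarith [mul_nonneg hβ0 hx.le, mul_nonneg (mul_nonneg hβ0 hx.le) hx.le,
          mul_nonneg hβ0 (show 0 ≤ g by linarith),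
          mul_nonneg (mul_nonneg hβ0 hx.le) (show 0 ≤ g by linarith)]
      calc (1 - β * g) * (x * -Real.log x) = ((1 - β * g) * x) * -Real.log x := by ring
        _ ≤ _ := mul_le_mul h2 h.le hlx.le (by positivity)
  have hstep : x + g ≤ (1 + g) / (1 + γ) * (x + γ) := by
    rw [div_mul_eq_mul_div, le_div_iff₀ (by linarith)]
    nlinarith
  calc (1 - β * γ) * (x * -Real.log x) ≤ (1 - β * g) * (x * -Real.log x) := by gcongr
    _ ≤ (β * x + 1) * (x + g) * Real.log ((x + g) / (β * x + 1)) := key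
    _ ≤ (β * x + 1) * ((1 + g) / (1 + γ) * (x + γ)) * Real.log ((x + γ) / (β * x + 1)) := by
      have : 0 ≤ (β * x + 1) * ((1 + g) / (1 + γ) * (x + γ)) :=
        mul_nonneg hA.le (hB.le.trans hstep)
      gcongr
    _ = _ := by ring

/-! ### The recursion in logarithmic coordinates -/

/-- The factor that a neighbour with ratio `x` contributes to the ratio of a vertex. -/
noncomputable def edgeFactor (β γ x : ℝ) : ℝ := (β * x + 1) / (x + γ)

/-- The recursion in logarithmic coordinates: `-log` of the factor contributed by a neighbour with
ratio `exp (-u)`. -/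
noncomputable def logFactor (β γ u : ℝ) : ℝ :=
  Real.log ((Real.exp (-u) + γ) / (β * Real.exp (-u) + 1))

theorem neg_log_edgeFactor_exp_neg (β γ u : ℝ) :
    -Real.log (edgeFactor β γ (Real.exp (-u))) = logFactor β γ u := by
  rw [edgeFactor, logFactor, ← Real.log_inv, inv_div]

theorem edgeFactor_le {β γ x : ℝ} (hβγ : β * γ < 1) (hγ : 1 < γ) (hx : 0 ≤ x) :
    edgeFactor β γ x ≤ γ⁻¹ := by
  rw [edgeFactor, div_le_iff₀ (by linarith), ← sub_nonneg]
  have : γ⁻¹ * (x + γ) - (β * x + 1) = x * (1 - β * γ) / γ := by field_simp; ring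
  rw [this]
  exact div_nonneg (mul_nonneg hx (by linarith)) (by linarith)

theorem le_edgeFactor {β γ x : ℝ} (hβ0 : 0 ≤ β) (hγ : 1 < γ)
    (hx : 0 ≤ x) (hx1 : x ≤ 1) : (1 + γ)⁻¹ ≤ edgeFactor β γ x := by
  rw [edgeFactor, inv_le_iff_one_le_mul₀ (by linarith), div_mul_eq_mul_div,
    one_le_div (by linarith)]
  nlinarith [mul_nonneg hβ0 hx, mul_nonneg (mul_nonneg hβ0 hx) (show 0 ≤ γ by linarith)]

theorem log_le_logFactor {β γ : ℝ} (hβ0 : 0 ≤ β) (hγ : 1 < γ) (hβγ : β * γ < 1) (u : ℝ) :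
    Real.log γ ≤ logFactor β γ u := by
  have hE := Real.exp_pos (-u)
  rw [← neg_log_edgeFactor_exp_neg, le_neg, ← Real.log_inv]
  refine Real.log_le_log ?_ (edgeFactor_le hβγ hγ hE.le)
  rw [edgeFactor]
  have : 0 ≤ β * Real.exp (-u) := by positivity
  exact div_pos (by linarith) (by linarith)

theorem logFactor_pos {β γ : ℝ} (hβ0 : 0 ≤ β) (hγ : 1 < γ) (hβγ : β * γ < 1) (u : ℝ) :
    0 < logFactor β γ u :=
  (Real.log_pos hγ).trans_le (log_le_logFactor hβ0 hγ hβγ u)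

theorem hasDerivAt_logFactor {β γ : ℝ} (hβ0 : 0 ≤ β) (hγ : 1 < γ) (u : ℝ) :
    HasDerivAt (logFactor β γ) (-((1 - β * γ) * Real.exp (-u) /
      ((β * Real.exp (-u) + 1) * (Real.exp (-u) + γ)))) u := by
  have hE := Real.exp_pos (-u)
  have hA : 0 < β * Real.exp (-u) + 1 := by positivity
  have hB : 0 < Real.exp (-u) + γ := by linarith
  have he : HasDerivAt (fun u : ℝ => Real.exp (-u)) (-Real.exp (-u)) u := by
    simpa using (hasDerivAt_neg u).exp
  have h := ((he.add_const γ).div ((he.const_mul β).add_const 1) hA.ne').log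
    (div_pos hB hA).ne'
  refine h.congr_deriv ?_
  simp only [Pi.div_apply]
  field_simp
  ring

theorem antitone_logFactor {β γ : ℝ} (hβ0 : 0 ≤ β) (hγ : 1 < γ) (hβγ : β * γ < 1) :
    Antitone (logFactor β γ) := by
  refine antitone_of_hasDerivAt_nonpos (fun u => hasDerivAt_logFactor hβ0 hγ u) fun u => ?_
  have hE := Real.exp_pos (-u)
  refine neg_nonpos.2 ?_
  exact div_nonneg (mul_nonneg (by linarith) hE.le)
    (mul_nonneg (by positivity) (by linarith))

/-- A bound on the logarithmic derivative of `logFactor` makes it a contraction for the metric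
`|log u - log v|`. -/
theorem log_logFactor_sub_le {β γ a α : ℝ} (hβ0 : 0 ≤ β) (hγ : 1 < γ) (hβγ : β * γ < 1)
    (ha : 0 < a)
    (hα : ∀ u, a ≤ u → (1 - β * γ) * (Real.exp (-u) * u) ≤
      α * ((β * Real.exp (-u) + 1) * (Real.exp (-u) + γ) * logFactor β γ u))
    {u v : ℝ} (hu : a ≤ u) (huv : u ≤ v) :
    Real.log (logFactor β γ u) - Real.log (logFactor β γ v) ≤
      α * (Real.log v - Real.log u) := by
  have hd : ∀ w, a ≤ w → HasDerivAt (fun w => Real.log (logFactor β γ w) + α * Real.log w)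
      (-((1 - β * γ) * Real.exp (-w) / ((β * Real.exp (-w) + 1) * (Real.exp (-w) + γ))) /
        logFactor β γ w + α * w⁻¹) w := fun w hw =>
    ((hasDerivAt_logFactor hβ0 hγ w).log (logFactor_pos hβ0 hγ hβγ w).ne').add
      ((Real.hasDerivAt_log (by linarith)).const_mul α)
  have hmono : MonotoneOn (fun w => Real.log (logFactor β γ w) + α * Real.log w) (Set.Ici a) := by
    refine monotoneOn_of_hasDerivWithinAt_nonneg (convex_Ici a)
      (fun w hw => (hd w hw).continuousAt.continuousWithinAt)
      (fun w hw => (hd w (interior_subset hw)).hasDerivWithinAt) fun w hw => ?_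
    have hw : a ≤ w := interior_subset hw
    have hw0 : 0 < w := by linarith
    have hE := Real.exp_pos (-w)
    have hA : 0 < β * Real.exp (-w) + 1 := by positivity
    have hB : 0 < Real.exp (-w) + γ := by linarith
    have hH := logFactor_pos hβ0 hγ hβγ w
    rw [neg_div, neg_add_eq_sub, sub_nonneg, div_div, ← div_eq_mul_inv,
      div_le_div_iff₀ (by positivity) hw0]
    calc _ = (1 - β * γ) * (Real.exp (-w) * w) := by ring
      _ ≤ _ := hα w hw
  have := hmono (Set.mem_Ici.2 hu) (Set.mem_Ici.2 (hu.trans huv)) huv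
  simp only at this
  linarith

/-! ### Decay rates -/

/-- Two bounds, one a constant below `1` and one exponentially small with an arbitrary
constant, combine to exponential decay without a constant. -/
theorem exists_exp_decay {ρ C a : ℝ} (hρ0 : 0 < ρ) (hρ1 : ρ < 1) (ha : 0 < a) :
    ∃ c : ℝ, 0 < c ∧ ∀ n : ℕ, min ρ (C * Real.exp (-(a * n))) ≤ Real.exp (-(c * n)) := by
  have hlρ : 0 < -Real.log ρ := neg_pos.2 (Real.log_neg hρ0 hρ1)
  obtain ⟨N, hN⟩ := exists_nat_gt (Real.log (max C 1) / (a / 2))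
  rw [div_lt_iff₀ (by linarith)] at hN
  refine ⟨min (a / 2) (-Real.log ρ / (N + 1)), lt_min (by linarith) (by positivity), fun n => ?_⟩
  rcases le_or_gt n N with h | h
  · refine (min_le_left _ _).trans ?_
    rw [← Real.log_le_iff_le_exp hρ0, le_neg]
    have hn : (n : ℝ) ≤ N + 1 := by exact_mod_cast h.trans (Nat.le_succ N)
    calc _ ≤ -Real.log ρ / (N + 1) * (N + 1) := by gcongr; exact min_le_right _ _
      _ = _ := by field_simp
  · refine (min_le_right _ _).trans ?_
    have hn : (N : ℝ) ≤ n := by exact_mod_cast h.le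
    calc C * Real.exp (-(a * n)) ≤ Real.exp (Real.log (max C 1)) * Real.exp (-(a * n)) := by
          rw [Real.exp_log (by positivity)]; gcongr; exact le_max_left _ _
      _ = Real.exp (Real.log (max C 1) - a * n) := by rw [← Real.exp_add]; ring_nf
      _ ≤ _ := by
        apply Real.exp_le_exp.2
        have h1 : min (a / 2) (-Real.log ρ / (N + 1)) * n ≤ a / 2 * n := by
          gcongr; exact min_le_left _ _
        have h2 : (N : ℝ) * (a / 2) ≤ n * (a / 2) := by gcongr
        linarith

/-- At a vertex with `n` children, `u ≥ n log γ`; there the derivative decays exponentially in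
`n`. -/
theorem exists_contraction_rate {β γ : ℝ} (hβ0 : 0 ≤ β) (hβ1 : β < 1) (hβγ : β * γ < 1)
    (hγ : uniquenessThreshold β < γ) :
    ∃ c : ℝ, 0 < c ∧ ∀ (n : ℕ) (u : ℝ), 0 < u → n * Real.log γ ≤ u →
      (1 - β * γ) * (Real.exp (-u) * u) ≤ Real.exp (-(c * n)) *
        ((β * Real.exp (-u) + 1) * (Real.exp (-u) + γ) * logFactor β γ u) := by
  obtain ⟨h1, ρ, hρ0, hρ1, hρ⟩ := exists_contraction_bound hβ0 hβ1 hγ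
  have hl : 0 < Real.log γ := Real.log_pos h1
  obtain ⟨c, hc, hdecay⟩ := exists_exp_decay (C := 2 / Real.log γ) hρ0 hρ1 (half_pos hl)
  refine ⟨c, hc, fun n u hu hnu => ?_⟩
  have hE := Real.exp_pos (-u)
  have hD : 0 < (β * Real.exp (-u) + 1) * (Real.exp (-u) + γ) * logFactor β γ u :=
    mul_pos (mul_pos (by positivity) (by linarith)) (logFactor_pos hβ0 h1 hβγ u)
  refine le_trans ?_ (mul_le_mul_of_nonneg_right (hdecay n) hD.le)
  rw [min_mul_of_nonneg _ _ hD.le]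
  refine le_min ?_ ?_
  · have := hρ (Real.exp (-u)) hE (by simpa using hu)
    rwa [Real.log_exp, neg_neg] at this
  · have e1 : Real.exp (-u) * u ≤ 2 * Real.exp (-(Real.log γ / 2 * n)) := by
      have h2 : u ≤ 2 * Real.exp (u / 2) := by
        have := Real.add_one_le_exp (u / 2)
        linarith
      calc Real.exp (-u) * u ≤ Real.exp (-u) * (2 * Real.exp (u / 2)) := by gcongr
        _ = 2 * Real.exp (-(u / 2)) := by
          rw [mul_left_comm, ← Real.exp_add]; ring_nf
        _ ≤ _ := by gcongr; linarith
    have e2 : Real.log γ ≤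
        (β * Real.exp (-u) + 1) * (Real.exp (-u) + γ) * logFactor β γ u := by
      have : 1 ≤ (β * Real.exp (-u) + 1) * (Real.exp (-u) + γ) :=
        one_le_mul_of_one_le_of_one_le (le_add_of_nonneg_left (by positivity)) (by linarith)
      nlinarith [log_le_logFactor hβ0 h1 hβγ u]
    calc (1 - β * γ) * (Real.exp (-u) * u) ≤ 1 * (Real.exp (-u) * u) := by
          gcongr
          nlinarith [mul_nonneg hβ0 (show 0 ≤ γ by linarith)]
      _ ≤ 2 * Real.exp (-(Real.log γ / 2 * n)) := by rw [one_mul]; exact e1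
      _ = 2 / Real.log γ * Real.exp (-(Real.log γ / 2 * n)) * Real.log γ := by field_simp
      _ ≤ _ := by gcongr

/-! ### Contraction of the tree recursion -/

/-- Two messages are equal, or both are positive and their distance in the coordinate
`log (-log y)` is at most `B`. The first case covers the message `0`, which a vertex pinned to
blue sends if `β = 0`. -/
def LogLogClose (B y y' : ℝ) : Prop :=
  y = y' ∨ 0 < y ∧ 0 < y' ∧ |Real.log (-Real.log y) - Real.log (-Real.log y')| ≤ B

theorem LogLogClose.mono {B B' y y' : ℝ} (h : LogLogClose B y y') (hB : B ≤ B') :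
    LogLogClose B' y y' :=
  h.imp_right fun h => ⟨h.1, h.2.1, h.2.2.trans hB⟩

/-- Since `log (-log y)` turns products into sums, and a sum of positive terms changes by a factor
of at most `exp B` if all its terms do, no symmetrization over the children is needed. -/
theorem logLogClose_edgeFactor_prod {β γ c B : ℝ} (hβ0 : 0 ≤ β) (hβγ : β * γ < 1) (hγ : 1 < γ)
    (hc : ∀ (n : ℕ) (u : ℝ), 0 < u → n * Real.log γ ≤ u →
      (1 - β * γ) * (Real.exp (-u) * u) ≤ Real.exp (-(c * n)) *
        ((β * Real.exp (-u) + 1) * (Real.exp (-u) + γ) * logFactor β γ u))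
    {ι : Type*} [Fintype ι] (y y' : ι → ℝ)
    (hy0 : ∀ i, 0 ≤ y i) (hy : ∀ i, y i ≤ γ⁻¹) (hy' : ∀ i, y' i ≤ γ⁻¹)
    (h : ∀ i, LogLogClose B (y i) (y' i)) :
    LogLogClose (Real.exp (-(c * Fintype.card ι)) * B)
      (edgeFactor β γ (∏ i, y i)) (edgeFactor β γ (∏ i, y' i)) := by
  rcases isEmpty_or_nonempty ι with hι | hι
  · left; simp
  by_cases hz : ∃ i, y i = 0
  · obtain ⟨i, hi⟩ := hz
    have hi' : y' i = 0 := by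
      rcases h i with h | h
      · rw [← h, hi]
      · exact absurd hi h.1.ne'
    left
    rw [Finset.prod_eq_zero (Finset.mem_univ i) hi, Finset.prod_eq_zero (Finset.mem_univ i) hi']
  push Not at hz
  by_cases heq : ∀ i, y i = y' i
  · left; rw [Finset.prod_congr rfl fun i _ => heq i]
  have hB : 0 ≤ B := by
    push Not at heq
    obtain ⟨i, hi⟩ := heq
    exact (abs_nonneg _).trans ((h i).resolve_left hi).2.2
  have hp : ∀ i, 0 < y i := fun i => lt_of_le_of_ne (hy0 i) (hz i).symm
  have hp' : ∀ i, 0 < y' i := fun i => by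
    rcases h i with h | h
    · rw [← h]; exact hp i
    · exact h.2.1
  have hlγ : 0 < Real.log γ := Real.log_pos hγ
  have hl : ∀ z : ℝ, 0 < z → z ≤ γ⁻¹ → Real.log γ ≤ -Real.log z := fun z hz hz' => by
    rw [le_neg, ← Real.log_inv]; exact Real.log_le_log hz hz'
  have hclose : ∀ i, |Real.log (-Real.log (y i)) - Real.log (-Real.log (y' i))| ≤ B := fun i => by
    rcases h i with h | h
    · rw [h, sub_self, abs_zero]; exact hB
    · exact h.2.2
  have hmul : ∀ s t : ℝ, 0 < s → 0 < t → Real.log s - Real.log t ≤ B → s ≤ Real.exp B * t :=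
    fun s t hs ht hst => by
      rw [← Real.log_le_log_iff hs (by positivity), Real.log_mul (Real.exp_pos B).ne' ht.ne',
        Real.log_exp]
      linarith
  have hsum : ∀ f g : ι → ℝ, (∀ i, 0 < f i) → (∀ i, 0 < g i) →
      (∀ i, Real.log (f i) - Real.log (g i) ≤ B) →
      Real.log (∑ i, f i) - Real.log (∑ i, g i) ≤ B := fun f g hf hg hfg => by
    have h1 : ∑ i, f i ≤ Real.exp B * ∑ i, g i := by
      rw [Finset.mul_sum]
      exact Finset.sum_le_sum fun i _ => hmul _ _ (hf i) (hg i) (hfg i)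
    have hf' : 0 < ∑ i, f i := Finset.sum_pos (fun i _ => hf i) Finset.univ_nonempty
    have hg' : 0 < ∑ i, g i := Finset.sum_pos (fun i _ => hg i) Finset.univ_nonempty
    have h2 := Real.log_le_log hf' h1
    rw [Real.log_mul (Real.exp_pos B).ne' hg'.ne', Real.log_exp] at h2
    linarith
  set u := ∑ i, -Real.log (y i) with hu
  set u' := ∑ i, -Real.log (y' i) with hu'
  have hpos : ∀ i, 0 < -Real.log (y i) := fun i => hlγ.trans_le (hl _ (hp i) (hy i))
  have hpos' : ∀ i, 0 < -Real.log (y' i) := fun i => hlγ.trans_le (hl _ (hp' i) (hy' i))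
  have hle : Fintype.card ι * Real.log γ ≤ u := by
    simpa [hu] using Finset.card_nsmul_le_sum Finset.univ _ _ fun i _ => hl _ (hp i) (hy i)
  have hle' : Fintype.card ι * Real.log γ ≤ u' := by
    simpa [hu'] using Finset.card_nsmul_le_sum Finset.univ _ _ fun i _ => hl _ (hp' i) (hy' i)
  have hcard : (0 : ℝ) < Fintype.card ι * Real.log γ :=
    mul_pos (by exact_mod_cast Fintype.card_pos) hlγ
  have hprod : ∏ i, y i = Real.exp (-u) := by
    rw [hu, Finset.sum_neg_distrib, neg_neg, Real.exp_sum]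
    exact Finset.prod_congr rfl fun i _ => (Real.exp_log (hp i)).symm
  have hprod' : ∏ i, y' i = Real.exp (-u') := by
    rw [hu', Finset.sum_neg_distrib, neg_neg, Real.exp_sum]
    exact Finset.prod_congr rfl fun i _ => (Real.exp_log (hp' i)).symm
  have hd1 : Real.log u - Real.log u' ≤ B :=
    hsum _ _ hpos hpos' fun i => (abs_le.1 (hclose i)).2
  have hd2 : Real.log u' - Real.log u ≤ B :=
    hsum _ _ hpos' hpos fun i => by linarith [(abs_le.1 (hclose i)).1]
  have hef : ∀ w : ℝ, 0 < edgeFactor β γ (Real.exp (-w)) := fun w =>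
    div_pos (by positivity) (by linarith [Real.exp_pos (-w)])
  refine Or.inr ⟨hprod ▸ hef u, hprod' ▸ hef u', ?_⟩
  rw [hprod, hprod', neg_log_edgeFactor_exp_neg, neg_log_edgeFactor_exp_neg]
  have hα := fun w (hw : Fintype.card ι * Real.log γ ≤ w) =>
    hc (Fintype.card ι) w (hcard.trans_le hw) hw
  have hexp := (Real.exp_pos (-(c * Fintype.card ι))).le
  have main : ∀ s t : ℝ, Fintype.card ι * Real.log γ ≤ s → s ≤ t →
      Real.log t - Real.log s ≤ B →
      |Real.log (logFactor β γ s) - Real.log (logFactor β γ t)| ≤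
        Real.exp (-(c * Fintype.card ι)) * B := fun s t hs hst hB => by
    rw [abs_of_nonneg]
    · exact (log_logFactor_sub_le hβ0 hγ hβγ hcard hα hs hst).trans
        (mul_le_mul_of_nonneg_left hB hexp)
    · rw [sub_nonneg]
      exact Real.log_le_log (logFactor_pos hβ0 hγ hβγ t) (antitone_logFactor hβ0 hγ hβγ hst)
  rcases le_total u u' with huu | huu
  · exact main u u' hle huu hd2
  · rw [abs_sub_comm]
    exact main u' u hle' huu hd1

theorem neg_log_edgeFactor_bounds {β γ x : ℝ} (hβ0 : 0 ≤ β) (hβγ : β * γ < 1) (hγ : 1 < γ)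
    (hx : 0 ≤ x) (hx1 : x ≤ 1) :
    Real.log γ ≤ -Real.log (edgeFactor β γ x) ∧
      -Real.log (edgeFactor β γ x) ≤ Real.log (1 + γ) := by
  have h1 := le_edgeFactor hβ0 hγ hx hx1
  have h0 : (0 : ℝ) < (1 + γ)⁻¹ := by positivity
  constructor
  · rw [le_neg, ← Real.log_inv]
    exact Real.log_le_log (h0.trans_le h1) (edgeFactor_le hβγ hγ hx)
  · rw [neg_le, ← Real.log_inv]
    exact Real.log_le_log h0 h1

/-- The messages of free vertices have bounded diameter. -/
theorem logLogClose_edgeFactor {β γ x x' : ℝ} (hβ0 : 0 ≤ β) (hβγ : β * γ < 1) (hγ : 1 < γ)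
    (hx : 0 ≤ x) (hx1 : x ≤ 1) (hx' : 0 ≤ x') (hx1' : x' ≤ 1) :
    LogLogClose (Real.log (Real.log (1 + γ)) - Real.log (Real.log γ))
      (edgeFactor β γ x) (edgeFactor β γ x') := by
  have h0 : (0 : ℝ) < (1 + γ)⁻¹ := by positivity
  have hl := Real.log_pos hγ
  obtain ⟨a1, a2⟩ := neg_log_edgeFactor_bounds hβ0 hβγ hγ hx hx1
  obtain ⟨b1, b2⟩ := neg_log_edgeFactor_bounds hβ0 hβγ hγ hx' hx1'
  refine Or.inr ⟨h0.trans_le (le_edgeFactor hβ0 hγ hx hx1),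
    h0.trans_le (le_edgeFactor hβ0 hγ hx' hx1'), ?_⟩
  have a3 := Real.log_le_log hl a1
  have a4 := Real.log_le_log (hl.trans_le a1) a2
  have b3 := Real.log_le_log hl b1
  have b4 := Real.log_le_log (hl.trans_le b1) b2
  rw [abs_le]
  constructor <;> linarith

theorem sub_le_mul_log_sub_log {M s t : ℝ} (hs : 0 < s) (ht : 0 < t) (hM : t ≤ M)
    (hst : s ≤ t) : t - s ≤ M * (Real.log t - Real.log s) := by
  have h := Real.one_sub_inv_le_log_of_pos (div_pos ht hs)
  rw [Real.log_div ht.ne' hs.ne', inv_div] at h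
  have h1 : 0 ≤ Real.log t - Real.log s := sub_nonneg.2 (Real.log_le_log hs hst)
  calc t - s = t * (1 - s / t) := by field_simp
    _ ≤ t * (Real.log t - Real.log s) := by gcongr
    _ ≤ _ := by gcongr

theorem abs_sub_le_mul_abs_log_sub_log {M s t : ℝ} (hs : 0 < s) (ht : 0 < t) (hsM : s ≤ M)
    (htM : t ≤ M) : |s - t| ≤ M * |Real.log s - Real.log t| := by
  rcases le_total s t with h | h
  · rw [abs_sub_comm, abs_sub_comm (Real.log s), abs_of_nonneg (sub_nonneg.2 h),
      abs_of_nonneg (sub_nonneg.2 (Real.log_le_log hs h))]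
    exact sub_le_mul_log_sub_log hs ht htM h
  · rw [abs_of_nonneg (sub_nonneg.2 h), abs_of_nonneg (sub_nonneg.2 (Real.log_le_log ht h))]
    exact sub_le_mul_log_sub_log ht hs hsM h

/-- The passage back from the coordinate `log (-log y)` of the message to the ratio. -/
theorem abs_sub_le_of_logLogClose {β γ x x' B : ℝ} (hβ0 : 0 ≤ β) (hβγ : β * γ < 1) (hγ : 1 < γ)
    (hx : 0 ≤ x) (hx1 : x ≤ 1) (hx' : 0 ≤ x') (hx1' : x' ≤ 1) (hB : 0 ≤ B)
    (h : LogLogClose B (edgeFactor β γ x) (edgeFactor β γ x')) :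
    |x - x'| ≤ (1 + γ) ^ 2 / (1 - β * γ) * Real.log (1 + γ) * B := by
  have h0 : (0 : ℝ) < (1 + γ)⁻¹ := by positivity
  have hl := Real.log_pos hγ
  obtain ⟨a1, a2⟩ := neg_log_edgeFactor_bounds hβ0 hβγ hγ hx hx1
  obtain ⟨b1, b2⟩ := neg_log_edgeFactor_bounds hβ0 hβγ hγ hx' hx1'
  have hp := h0.trans_le (le_edgeFactor hβ0 hγ hx hx1)
  have hp' := h0.trans_le (le_edgeFactor hβ0 hγ hx' hx1')
  have hle : ∀ z : ℝ, 0 ≤ z → edgeFactor β γ z ≤ 1 := fun z hz =>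
    (edgeFactor_le hβγ hγ hz).trans (inv_le_one_of_one_le₀ hγ.le)
  have hK : 0 < Real.log (1 + γ) := Real.log_pos (by linarith)
  have hclose : |Real.log (-Real.log (edgeFactor β γ x)) -
      Real.log (-Real.log (edgeFactor β γ x'))| ≤ B := by
    rcases h with h | h
    · simpa [h] using hB
    · exact h.2.2
  have e1 : |edgeFactor β γ x - edgeFactor β γ x'| ≤ Real.log (1 + γ) * B :=
    calc _ ≤ 1 * |Real.log (edgeFactor β γ x) - Real.log (edgeFactor β γ x')| :=
          abs_sub_le_mul_abs_log_sub_log hp hp' (hle x hx) (hle x' hx')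
      _ = |-Real.log (edgeFactor β γ x) - -Real.log (edgeFactor β γ x')| := by
        rw [one_mul, neg_sub_neg, abs_sub_comm]
      _ ≤ Real.log (1 + γ) * _ :=
        abs_sub_le_mul_abs_log_sub_log (hl.trans_le a1) (hl.trans_le b1) a2 b2
      _ ≤ _ := by gcongr
  have e2 : edgeFactor β γ x - edgeFactor β γ x' =
      -((1 - β * γ) / ((x + γ) * (x' + γ)) * (x - x')) := by
    rw [edgeFactor, edgeFactor]
    field_simp
    ring
  have hd : (0 : ℝ) < (x + γ) * (x' + γ) := by positivity
  have h1 : 0 < 1 - β * γ := by linarith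
  rw [e2, abs_neg, abs_mul, abs_of_pos (div_pos h1 hd), div_mul_eq_mul_div, div_le_iff₀ hd] at e1
  have e3 : (x + γ) * (x' + γ) ≤ (1 + γ) ^ 2 := by
    rw [sq]; gcongr
  rw [div_mul_eq_mul_div, div_mul_eq_mul_div, le_div_iff₀ h1]
  calc |x - x'| * (1 - β * γ) = (1 - β * γ) * |x - x'| := mul_comm _ _
    _ ≤ _ := e1
    _ ≤ Real.log (1 + γ) * B * (1 + γ) ^ 2 := by gcongr
    _ = _ := by ring

/-! ### Summation over configurations by messages -/

theorem sum_sum_update {V : Type*} [Fintype V] [DecidableEq V] (ℓ : V)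
    (F : (V → Fin 2) → ℝ) :
    ∑ ξ : V → Fin 2, ∑ t, F (Function.update ξ ℓ t) = 2 * ∑ ξ, F ξ := by
  -- `(ξ, t) ↦ (update ξ ℓ t, ξ ℓ)` is an involution.
  let e : Equiv.Perm ((V → Fin 2) × Fin 2) :=
    Function.Involutive.toPerm (fun p => (Function.update p.1 ℓ p.2, p.1 ℓ)) fun p => by simp
  calc ∑ ξ : V → Fin 2, ∑ t, F (Function.update ξ ℓ t)
      = ∑ p : (V → Fin 2) × Fin 2, F (e p).1 := by
        rw [Fintype.sum_prod_type]; rfl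
    _ = ∑ p : (V → Fin 2) × Fin 2, F p.1 := Equiv.sum_comp e fun p => F p.1
    _ = 2 * ∑ ξ, F ξ := by
      rw [Fintype.sum_prod_type, Finset.mul_sum]; simp

section Elimination

variable {V : Type*} [Fintype V] [DecidableEq V]

/-- The factor of the vertex `v` in the weight of a configuration, after the spins of the vertices
in `T` are summed out: the message of a vertex of `T` whose parent is not in `T` replaces all
factors of its subtree. -/
noncomputable def eliminatedFactor (r : V) (par : V → V) (A : Fin 2 → Fin 2 → ℝ)
    (w m : V → Fin 2 → ℝ) (T : Finset V) (ξ : V → Fin 2) (v : V) : ℝ :=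
  if v ∈ T then (if par v ∈ T then 1 else ∑ t, A (ξ (par v)) t * m v t)
  else w v (ξ v) * if v = r then 1 else A (ξ (par v)) (ξ v)

variable {r : V} {par : V → V} {A : Fin 2 → Fin 2 → ℝ} {w m : V → Fin 2 → ℝ}

/-- Summing out one more vertex, all of whose children are summed out already. The factor `2`
appears because the spins that are summed out remain free in the configuration. -/
theorem sum_prod_eliminatedFactor_insert
    (hm : ∀ v s, m v s = w v s * ∏ c with c ≠ r ∧ par c = v, ∑ t, A s t * m c t)
    {T : Finset V} {ℓ : V} (hr : r ∉ T) (hℓ : ℓ ∉ T) (hℓr : ℓ ≠ r) (hpℓ : par ℓ ≠ ℓ)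
    (hpT : par ℓ ∉ T) (hch : ∀ c, c ≠ r → par c = ℓ → c ∈ T) :
    ∑ ξ : V → Fin 2, ∏ v, eliminatedFactor r par A w m (insert ℓ T) ξ v =
      2 * ∑ ξ : V → Fin 2, ∏ v, eliminatedFactor r par A w m T ξ v := by
  rw [← sum_sum_update ℓ]
  refine Finset.sum_congr rfl fun ξ _ => ?_
  set C : Finset V := {c | c ≠ r ∧ par c = ℓ} with hC
  have hℓC : ℓ ∉ C := by simp [hC, hpℓ]
  have hin : ∏ v ∈ insert ℓ C, eliminatedFactor r par A w m (insert ℓ T) ξ v =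
      ∑ t, A (ξ (par ℓ)) t * m ℓ t := by
    rw [Finset.prod_insert hℓC, Finset.prod_eq_one, mul_one]
    · simp [eliminatedFactor, hpℓ, hpT]
    · intro c hc
      obtain ⟨h1, h2⟩ := (Finset.mem_filter.1 hc).2
      simp [eliminatedFactor, hch c h1 h2, h2]
  have hout : ∀ t, ∏ v ∈ insert ℓ C, eliminatedFactor r par A w m T (Function.update ξ ℓ t) v =
      A (ξ (par ℓ)) t * m ℓ t := fun t => by
    rw [Finset.prod_insert hℓC, hm ℓ t]
    have : ∀ c ∈ C, eliminatedFactor r par A w m T (Function.update ξ ℓ t) c =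
        ∑ s, A t s * m c s := fun c hc => by
      obtain ⟨h1, h2⟩ := (Finset.mem_filter.1 hc).2
      simp [eliminatedFactor, hch c h1 h2, h2, hℓ]
    rw [Finset.prod_congr rfl this]
    simp only [eliminatedFactor, hℓ, hℓr, if_false, Function.update_self,
      Function.update_of_ne hpℓ]
    ring
  have hrest : ∀ t, ∀ v ∈ (insert ℓ C)ᶜ,
      eliminatedFactor r par A w m T (Function.update ξ ℓ t) v =
        eliminatedFactor r par A w m (insert ℓ T) ξ v := fun t v hv => by
    simp only [hC, Finset.mem_compl, Finset.mem_insert, Finset.mem_filter, Finset.mem_univ,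
      true_and, not_or, not_and] at hv
    obtain ⟨h1, h2⟩ := hv
    by_cases hvr : v = r
    · subst hvr
      simp [eliminatedFactor, hr, h1]
    · simp [eliminatedFactor, h1, h2 hvr]
  rw [← Finset.prod_mul_prod_compl (insert ℓ C), hin, Finset.sum_mul]
  refine Finset.sum_congr rfl fun t _ => ?_
  rw [← Finset.prod_mul_prod_compl (insert ℓ C), hout t, Finset.prod_congr rfl (hrest t)]

theorem sum_prod_eliminatedFactor {depth : V → ℕ}
    (hdepth : ∀ v, v ≠ r → depth (par v) < depth v)
    (hm : ∀ v s, m v s = w v s * ∏ c with c ≠ r ∧ par c = v, ∑ t, A s t * m c t)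
    (n : ℕ) : ∀ T : Finset V, T.card = n → r ∉ T → (∀ v, v ≠ r → par v ∈ T → v ∈ T) →
    ∑ ξ : V → Fin 2, ∏ v, eliminatedFactor r par A w m T ξ v =
      2 ^ n * ∑ ξ : V → Fin 2, ∏ v, eliminatedFactor r par A w m ∅ ξ v := by
  induction n with
  | zero =>
    intro T hT _ _
    rw [Finset.card_eq_zero.1 hT]; simp
  | succ n ih =>
    intro T hT hr hcl
    obtain ⟨ℓ, hℓ, hmin⟩ := Finset.exists_min_image T depth (Finset.card_pos.1 (by omega))
    have hℓr : ℓ ≠ r := fun h => hr (h ▸ hℓ)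
    have hpℓ : par ℓ ≠ ℓ := fun h => by
      have := hdepth ℓ hℓr
      rw [h] at this
      exact this.false
    have hpT : par ℓ ∉ T := fun h => absurd (hmin _ h) (not_le.2 (hdepth ℓ hℓr))
    have hne : ∀ c, c ≠ r → par c ∈ T → c ≠ ℓ := fun c _ h hc => hpT (hc ▸ h)
    have h1 := sum_prod_eliminatedFactor_insert (T := T.erase ℓ) hm
      (fun h => hr (Finset.mem_of_mem_erase h)) (Finset.notMem_erase ℓ T) hℓr hpℓ
      (fun h => hpT (Finset.mem_of_mem_erase h))
      (fun c hc hcℓ => Finset.mem_erase.2 ⟨hne c hc (hcℓ ▸ hℓ), hcl c hc (hcℓ ▸ hℓ)⟩)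
    rw [Finset.insert_erase hℓ] at h1
    rw [h1, ih (T.erase ℓ) (by rw [Finset.card_erase_of_mem hℓ]; omega)
      (fun h => hr (Finset.mem_of_mem_erase h))
      (fun v hv h => by
        have h' := Finset.mem_of_mem_erase h
        exact Finset.mem_erase.2 ⟨hne v hv h', hcl v hv h'⟩)]
    ring

/-- The total weight of all configurations is the sum of the two messages of the root. -/
theorem sum_weight_eq_sum_message {depth : V → ℕ}
    (hdepth : ∀ v, v ≠ r → depth (par v) < depth v)
    (hm : ∀ v s, m v s = w v s * ∏ c with c ≠ r ∧ par c = v, ∑ t, A s t * m c t) :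
    ∑ ξ : V → Fin 2, (∏ v, w v (ξ v)) * ∏ v with v ≠ r, A (ξ (par v)) (ξ v) =
      ∑ s, m r s := by
  have h0 : ∀ ξ : V → Fin 2, ∏ v, eliminatedFactor r par A w m ∅ ξ v =
      (∏ v, w v (ξ v)) * ∏ v with v ≠ r, A (ξ (par v)) (ξ v) := fun ξ => by
    simp only [eliminatedFactor, Finset.notMem_empty, if_false, Finset.prod_mul_distrib,
      Finset.prod_filter, ite_not]
  have h1 : ∀ ξ : V → Fin 2,
      ∏ v, eliminatedFactor r par A w m (Finset.univ.erase r) ξ v = m r (ξ r) := fun ξ => by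
    rw [← Finset.mul_prod_erase Finset.univ _ (Finset.mem_univ r), hm r (ξ r),
      Finset.prod_filter, ← Finset.mul_prod_erase Finset.univ _ (Finset.mem_univ r)]
    congr 1
    · simp [eliminatedFactor]
    · simp only [ne_eq, not_true, false_and, if_false, one_mul]
      refine Finset.prod_congr rfl fun v hv => ?_
      have hvr : v ≠ r := Finset.ne_of_mem_erase hv
      by_cases hp : par v = r <;> simp [eliminatedFactor, hvr, hp]
  have h2 := sum_prod_eliminatedFactor hdepth hm _ (Finset.univ.erase r) rfl
    (Finset.notMem_erase r _) (fun v hv _ => Finset.mem_erase.2 ⟨hv, Finset.mem_univ v⟩)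
  simp only [h0, h1] at h2
  have h3 := sum_sum_update r fun ξ => m r (ξ r)
  simp only [Function.update_self, Finset.sum_const, Finset.card_univ, Fintype.card_fun,
    Fintype.card_fin, nsmul_eq_mul, Nat.cast_pow, Nat.cast_ofNat] at h3
  rw [h2, ← mul_assoc, ← pow_succ', Finset.card_erase_of_mem (Finset.mem_univ r),
    Finset.card_univ, Nat.sub_add_cancel (Fintype.card_pos_iff.2 ⟨r⟩)] at h3
  exact (mul_left_cancel₀ (by positivity) h3).symm

/-- The total weight of all configurations with spin `s` at the root is the message of the root
at `s`: apply the formula for the total weight after deleting the other spin of the root. -/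
theorem sum_weight_root_eq_message {depth : V → ℕ}
    (hdepth : ∀ v, v ≠ r → depth (par v) < depth v)
    (hm : ∀ v s, m v s = w v s * ∏ c with c ≠ r ∧ par c = v, ∑ t, A s t * m c t) (s : Fin 2) :
    ∑ ξ : V → Fin 2, (if ξ r = s then
      (∏ v, w v (ξ v)) * ∏ v with v ≠ r, A (ξ (par v)) (ξ v) else 0) = m r s := by
  have h := sum_weight_eq_sum_message (w := fun v t => if v = r ∧ t ≠ s then 0 else w v t)
    (m := fun v t => if v = r ∧ t ≠ s then 0 else m v t) (A := A) hdepth fun v t => by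
      have : ∏ c with c ≠ r ∧ par c = v, ∑ t', A t t' * (if c = r ∧ t' ≠ s then 0 else m c t') =
          ∏ c with c ≠ r ∧ par c = v, ∑ t', A t t' * m c t' :=
        Finset.prod_congr rfl fun c hc => by simp [(Finset.mem_filter.1 hc).2.1]
      rw [this]
      split_ifs
      · simp
      · exact hm v t
  simp only [true_and, ne_eq, ite_not, Finset.sum_ite_eq', Finset.mem_univ, if_true] at h
  rw [← h]
  refine Finset.sum_congr rfl fun ξ _ => ?_
  split_ifs with hs
  · congr 1
    refine Finset.prod_congr rfl fun v _ => ?_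
    rw [if_neg]
    rintro ⟨rfl, h'⟩
    exact h' hs
  · rw [Finset.prod_eq_zero (Finset.mem_univ r) (by simp [hs]), zero_mul]

end Elimination

/-! ### Rooted trees -/

section Tree

variable {V : Type*} {T : SimpleGraph V} {r : V}

theorem isChild_or_isChild_of_adj (hT : T.IsTree) {u v : V} (h : T.Adj u v) :
    IsChild T r u v ∨ IsChild T r v u :=
  (hT.dist_eq_dist_add_one_of_adj r h).symm.imp (fun h' => ⟨h, h'⟩) fun h' => ⟨h.symm, h'⟩

theorem not_isChild_root (v : V) : ¬ IsChild T r v r := fun h => by simpa using h.2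

theorem exists_isChild (hT : T.IsTree) {v : V} (hv : v ≠ r) : ∃ p, IsChild T r p v := by
  obtain ⟨p, hp⟩ := hT.connected.exists_walk_length_eq_dist v r
  cases p with
  | nil => exact absurd rfl hv
  | @cons _ u _ h q =>
    refine ⟨u, (isChild_or_isChild_of_adj hT h).resolve_left fun hu => ?_⟩
    have h1 := hu.2
    have h2 := T.dist_le q
    rw [SimpleGraph.Walk.length_cons] at hp
    rw [T.dist_comm (u := r), T.dist_comm (u := r)] at h1
    omega

open Classical in
/-- The parent of a vertex other than the root; the root is its own parent, a value that is never
used. -/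
noncomputable def parent (T : SimpleGraph V) (r v : V) : V :=
  if h : ∃ p, IsChild T r p v then h.choose else v

theorem isChild_parent (hT : T.IsTree) {v : V} (hv : v ≠ r) : IsChild T r (parent T r v) v := by
  rw [parent, dif_pos (exists_isChild hT hv)]
  exact (exists_isChild hT hv).choose_spec

theorem isChild_iff (hT : T.IsTree) {v c : V} :
    IsChild T r v c ↔ c ≠ r ∧ parent T r c = v := by
  constructor
  · intro h
    have hc : c ≠ r := fun hc => not_isChild_root v (hc ▸ h)
    exact ⟨hc, (isChild_parent hT hc).parent_unique hT h⟩
  · rintro ⟨hc, rfl⟩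
    exact isChild_parent hT hc

open Classical in
theorem weight_eq_prod_parent [Fintype V] (hT : T.IsTree) (r : V) (β γ : ℝ) (ξ : V → Fin 2) :
    weight β γ T ξ = ∏ v with v ≠ r, interaction β γ (ξ (parent T r v)) (ξ v) := by
  symm
  refine Finset.prod_bij (fun v _ => s(parent T r v, v)) (fun v hv => ?_) (fun v hv u hu h => ?_)
    (fun e he => ?_) fun v _ => rfl
  · rw [SimpleGraph.mem_edgeFinset]
    exact (isChild_parent hT (Finset.mem_filter.1 hv).2).1
  · have h1 := (isChild_parent hT (Finset.mem_filter.1 hv).2).2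
    have h2 := (isChild_parent hT (Finset.mem_filter.1 hu).2).2
    rcases Sym2.eq_iff.1 h with h | h
    · exact h.2
    · rw [h.1] at h1
      rw [← h.2] at h2
      omega
  · induction e with
    | _ a b =>
      rw [SimpleGraph.mem_edgeFinset, SimpleGraph.mem_edgeSet] at he
      rcases isChild_or_isChild_of_adj (r := r) hT he with h | h
      · obtain ⟨h1, h2⟩ := (isChild_iff hT).1 h
        exact ⟨b, by simpa using h1, by rw [h2]⟩
      · obtain ⟨h1, h2⟩ := (isChild_iff hT).1 h
        exact ⟨a, by simpa using h1, by rw [h2, Sym2.eq_swap]⟩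

theorem sum_dist_sub_lt [Fintype V] {v c : V} (h : IsChild T r v c) :
    (∑ u, T.dist r u) - T.dist r c < (∑ u, T.dist r u) - T.dist r v := by
  have h1 := h.2
  have h2 : T.dist r c ≤ ∑ u, T.dist r u :=
    Finset.single_le_sum (f := fun u => T.dist r u) (fun _ _ => Nat.zero_le _)
      (Finset.mem_univ c)
  omega

/-- Induction from the leaves towards the root. -/
theorem induction_children [Finite V] {P : V → Prop}
    (h : ∀ v, (∀ c, IsChild T r v c → P c) → P v) (v : V) : P v := by
  have := Fintype.ofFinite V
  induction hn : (∑ u, T.dist r u) - T.dist r v using Nat.strong_induction_on generalizing v with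
  | _ n ih => exact h v fun c hc => ih _ (hn ▸ sum_dist_sub_lt hc) c rfl

theorem numChildren_eq_card [Fintype V] (v : V) [Fintype {c // IsChild T r v c}] :
    numChildren T r v = Fintype.card {c // IsChild T r v c} := by
  rw [numChildren, ← Nat.card_coe_set_eq, ← Nat.card_eq_fintype_card]
  rfl

end Tree

/-! ### Belief propagation on a tree with pinned vertices -/

open Classical in
/-- The indicator that the spin `s` at `v` is compatible with the partial configuration. -/
noncomputable def pinWeight {V : Type*} (Λ : Set V) (σ : Λ → Fin 2) (v : V) (s : Fin 2) : ℝ :=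
  if ∀ h : v ∈ Λ, s = σ ⟨v, h⟩ then 1 else 0

theorem pinWeight_nonneg {V : Type*} {Λ : Set V} {σ : Λ → Fin 2} (v : V) (s : Fin 2) :
    0 ≤ pinWeight Λ σ v s := by
  unfold pinWeight; split_ifs <;> norm_num

theorem pinWeight_of_notMem {V : Type*} {Λ : Set V} {σ : Λ → Fin 2} {v : V} (hv : v ∉ Λ) (s : Fin 2) :
    pinWeight Λ σ v s = 1 :=
  if_pos fun h => absurd h hv

open Classical in
/-- The weight of the subtree below `v`, summed over the configurations that extend the
partial configuration and have spin `s` at `v`. -/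
noncomputable def message {V : Type*} [Fintype V] (β γ : ℝ) (T : SimpleGraph V) (r : V)
    (Λ : Set V) (σ : Λ → Fin 2) (v : V) (s : Fin 2) : ℝ :=
  pinWeight Λ σ v s * ∏ c : {c // IsChild T r v c},
    ∑ t, interaction β γ s t * message β γ T r Λ σ c t
termination_by (∑ u, T.dist r u) - T.dist r v
decreasing_by exact sum_dist_sub_lt c.2

/-- The factor that the subtree below `v` contributes to the ratio of its parent. -/
noncomputable def childFactor {V : Type*} [Fintype V] (β γ : ℝ) (T : SimpleGraph V) (r : V)
    (Λ : Set V) (σ : Λ → Fin 2) (v : V) : ℝ :=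
  (β * message β γ T r Λ σ v 0 + message β γ T r Λ σ v 1) /
    (message β γ T r Λ σ v 0 + γ * message β γ T r Λ σ v 1)

section Messages

variable {V : Type*} [Fintype V] {T : SimpleGraph V} {r : V} {β γ : ℝ} {Λ : Set V}
  {σ τ : Λ → Fin 2}

open Classical in
theorem message_eq_prod_parent (hT : T.IsTree) (v : V) (s : Fin 2) :
    message β γ T r Λ σ v s = pinWeight Λ σ v s *
      ∏ c with c ≠ r ∧ parent T r c = v, ∑ t, interaction β γ s t * message β γ T r Λ σ c t := by
  rw [message]
  congr 1
  exact (Finset.prod_subtype _ (fun c => by simp [isChild_iff hT])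
    fun c => ∑ t, interaction β γ s t * message β γ T r Λ σ c t).symm

open Classical in
theorem message_zero (v : V) :
    message β γ T r Λ σ v 0 = pinWeight Λ σ v 0 * ∏ c : {c // IsChild T r v c},
      (β * message β γ T r Λ σ c 0 + message β γ T r Λ σ c 1) := by
  rw [message]; simp [Fin.sum_univ_two, interaction]

open Classical in
theorem message_one (v : V) :
    message β γ T r Λ σ v 1 = pinWeight Λ σ v 1 * ∏ c : {c // IsChild T r v c},
      (message β γ T r Λ σ c 0 + γ * message β γ T r Λ σ c 1) := by
  rw [message]; simp [Fin.sum_univ_two, interaction]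

theorem message_nonneg (hβ0 : 0 ≤ β) (hγ : 0 ≤ γ) (v : V) (s : Fin 2) :
    0 ≤ message β γ T r Λ σ v s := by
  have h : ∀ s, 0 ≤ message β γ T r Λ σ v s := by
    induction v using induction_children (T := T) (r := r) with
    | h v ih =>
      intro s
      rw [message]
      refine mul_nonneg (pinWeight_nonneg v s) (Finset.prod_nonneg fun c _ =>
        Finset.sum_nonneg fun t _ => mul_nonneg ?_ (ih c c.2 t))
      fin_cases s <;> fin_cases t <;> simp [interaction, hβ0, hγ]
  exact h s

open Classical in
theorem prod_pinWeight (ξ : V → Fin 2) :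
    ∏ v, pinWeight Λ σ v (ξ v) = if ξ ∈ extending Λ σ then 1 else 0 := by
  split_ifs with h
  · refine Finset.prod_eq_one fun v _ => if_pos fun hv => h ⟨v, hv⟩
  · rw [extending, Set.mem_ofPred_eq, not_forall] at h
    obtain ⟨v, hv⟩ := h
    exact Finset.prod_eq_zero (Finset.mem_univ v.1) (if_neg fun h' => hv (h' v.2))

theorem gibbsProb_extending_inter (hT : T.IsTree) (s : Fin 2) :
    gibbsProb β γ T (extending Λ σ ∩ {ξ | ξ r = s}) =
      message β γ T r Λ σ r s / partitionFunction β γ T := by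
  classical
  rw [← sum_weight_root_eq_message (depth := T.dist r)
    (fun v hv => by have := (isChild_parent hT hv).2; omega)
    (message_eq_prod_parent (β := β) (γ := γ) (σ := σ) hT) s, Finset.sum_div, gibbsProb]
  refine Finset.sum_congr rfl fun ξ _ => ?_
  rw [prod_pinWeight, ← weight_eq_prod_parent hT, gibbs]
  by_cases h1 : ξ ∈ extending Λ σ <;> by_cases h2 : ξ r = s <;> simp [h1, h2]

theorem gibbsProb_extending (hT : T.IsTree) (r : V) :
    gibbsProb β γ T (extending Λ σ) =
      (message β γ T r Λ σ r 0 + message β γ T r Λ σ r 1) / partitionFunction β γ T := by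
  classical
  rw [add_div, ← gibbsProb_extending_inter hT, ← gibbsProb_extending_inter hT, gibbsProb,
    gibbsProb, gibbsProb, ← Finset.sum_add_distrib]
  refine Finset.sum_congr rfl fun ξ _ => ?_
  rcases (by omega : ξ r = 0 ∨ ξ r = 1) with h | h <;>
    by_cases h1 : ξ ∈ extending Λ σ <;> simp [h, h1]

theorem message_root_pos (hβ0 : 0 ≤ β) (hγ : 0 ≤ γ) (hT : T.IsTree) (h : Feasible β γ T Λ σ) :
    0 < message β γ T r Λ σ r 0 + message β γ T r Λ σ r 1 := by
  rw [Feasible, gibbsProb_extending hT r] at h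
  refine lt_of_le_of_ne (add_nonneg (message_nonneg hβ0 hγ r 0) (message_nonneg hβ0 hγ r 1))
    fun h0 => ?_
  rw [← h0, zero_div] at h
  exact h.false

open Classical in
/-- Feasibility passes to all subtrees: a subtree of weight `0` would make its parent's
messages vanish. -/
theorem message_pos (hβ0 : 0 ≤ β) (hγ : 0 ≤ γ) (hT : T.IsTree) (h : Feasible β γ T Λ σ) (v : V) :
    0 < message β γ T r Λ σ v 0 + message β γ T r Λ σ v 1 := by
  induction hn : T.dist r v generalizing v with
  | zero =>
    rw [hT.connected.dist_eq_zero_iff] at hn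
    exact hn ▸ message_root_pos hβ0 hγ hT h
  | succ n ih =>
    have hv : v ≠ r := fun hv => by simp [hv] at hn
    have hp := isChild_parent hT hv
    have hpos := ih (parent T r v) (by have := hp.2; omega)
    have n0 := message_nonneg (T := T) (r := r) (σ := σ) hβ0 hγ v 0
    have n1 := message_nonneg (T := T) (r := r) (σ := σ) hβ0 hγ v 1
    refine lt_of_le_of_ne (add_nonneg n0 n1) fun h0 => hpos.ne' ?_
    have m0 : message β γ T r Λ σ v 0 = 0 := by linarith
    have m1 : message β γ T r Λ σ v 1 = 0 := by linarith
    rw [message_zero, message_one,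
      Finset.prod_eq_zero (Finset.mem_univ (⟨v, hp⟩ : {c // IsChild T r (parent T r v) c}))
        (by simp [m0, m1]),
      Finset.prod_eq_zero (Finset.mem_univ (⟨v, hp⟩ : {c // IsChild T r (parent T r v) c}))
        (by simp [m0, m1])]
    simp

theorem message_zero_add_mul_message_one_pos (hβ0 : 0 ≤ β) (hγ : 0 < γ) (hT : T.IsTree)
    (h : Feasible β γ T Λ σ) (v : V) :
    0 < message β γ T r Λ σ v 0 + γ * message β γ T r Λ σ v 1 := by
  have h0 := message_nonneg (T := T) (r := r) (σ := σ) hβ0 hγ.le v 0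
  have h1 := message_nonneg (T := T) (r := r) (σ := σ) hβ0 hγ.le v 1
  have hp := message_pos (r := r) hβ0 hγ.le hT h v
  rcases h1.eq_or_lt with h1 | h1
  · rw [← h1] at hp ⊢; linarith
  · have := mul_pos hγ h1; linarith

theorem childFactor_nonneg (hβ0 : 0 ≤ β) (hγ : 0 ≤ γ) (v : V) :
    0 ≤ childFactor β γ T r Λ σ v := by
  have h0 := message_nonneg (T := T) (r := r) (σ := σ) hβ0 hγ v 0
  have h1 := message_nonneg (T := T) (r := r) (σ := σ) hβ0 hγ v 1
  exact div_nonneg (by positivity) (by positivity)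

theorem childFactor_le (hβ0 : 0 ≤ β) (hβγ : β * γ < 1) (hγ : 0 < γ) (hT : T.IsTree)
    (h : Feasible β γ T Λ σ) (v : V) : childFactor β γ T r Λ σ v ≤ γ⁻¹ := by
  have h0 := message_nonneg (T := T) (r := r) (σ := σ) hβ0 hγ.le v 0
  rw [childFactor, div_le_iff₀ (message_zero_add_mul_message_one_pos hβ0 hγ hT h v), mul_add,
    inv_mul_cancel_left₀ hγ.ne']
  have : β ≤ γ⁻¹ := by rw [← one_div, le_div_iff₀ hγ]; exact hβγ.le
  gcongr

theorem message_eq_zero_of_ne {v : V} (hv : v ∈ Λ) {s : Fin 2} (hs : s ≠ σ ⟨v, hv⟩) :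
    message β γ T r Λ σ v s = 0 := by
  rw [message, pinWeight, if_neg fun h => hs (h hv), zero_mul]

/-- A pinned vertex sends `β` or `1 / γ`, independently of its subtree. -/
theorem childFactor_congr (hβ0 : 0 ≤ β) (hγ : 0 < γ) (hT : T.IsTree)
    (hσ : Feasible β γ T Λ σ) (hτ : Feasible β γ T Λ τ) {v : V} (hv : v ∈ Λ)
    (h : σ ⟨v, hv⟩ = τ ⟨v, hv⟩) :
    childFactor β γ T r Λ σ v = childFactor β γ T r Λ τ v := by
  have pσ := message_zero_add_mul_message_one_pos (r := r) hβ0 hγ hT hσ v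
  have pτ := message_zero_add_mul_message_one_pos (r := r) hβ0 hγ hT hτ v
  rw [childFactor, childFactor]
  rcases (by omega : σ ⟨v, hv⟩ = 0 ∨ σ ⟨v, hv⟩ = 1) with h0 | h0
  · have e1 : message β γ T r Λ σ v 1 = 0 := message_eq_zero_of_ne hv (by rw [h0]; decide)
    have e2 : message β γ T r Λ τ v 1 = 0 := message_eq_zero_of_ne hv (by rw [← h, h0]; decide)
    rw [e1] at pσ ⊢
    rw [e2] at pτ ⊢
    simp only [mul_zero, add_zero] at pσ pτ ⊢
    rw [mul_div_cancel_right₀ _ pσ.ne', mul_div_cancel_right₀ _ pτ.ne']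
  · have e1 : message β γ T r Λ σ v 0 = 0 := message_eq_zero_of_ne hv (by rw [h0]; decide)
    have e2 : message β γ T r Λ τ v 0 = 0 := message_eq_zero_of_ne hv (by rw [← h, h0]; decide)
    rw [e1] at pσ ⊢
    rw [e2] at pτ ⊢
    simp only [mul_zero, zero_add] at pσ pτ ⊢
    rw [div_mul_cancel_right₀ (right_ne_zero_of_mul pσ.ne'),
      div_mul_cancel_right₀ (right_ne_zero_of_mul pτ.ne')]

open Classical in
theorem message_one_pos_of_notMem (hβ0 : 0 ≤ β) (hγ : 0 < γ) (hT : T.IsTree)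
    (h : Feasible β γ T Λ σ) {v : V} (hv : v ∉ Λ) : 0 < message β γ T r Λ σ v 1 := by
  rw [message_one, pinWeight_of_notMem hv, one_mul]
  exact Finset.prod_pos fun c _ => message_zero_add_mul_message_one_pos hβ0 hγ hT h c

open Classical in
theorem prod_childFactor {v : V} (hv : v ∉ Λ) :
    ∏ c : {c // IsChild T r v c}, childFactor β γ T r Λ σ c =
      message β γ T r Λ σ v 0 / message β γ T r Λ σ v 1 := by
  rw [message_zero, message_one, pinWeight_of_notMem hv, pinWeight_of_notMem hv, one_mul, one_mul,
    ← Finset.prod_div_distrib]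
  rfl

open Classical in
/-- The tree recursion. -/
theorem childFactor_eq_edgeFactor (hβ0 : 0 ≤ β) (hγ : 0 < γ) (hT : T.IsTree)
    (h : Feasible β γ T Λ σ) {v : V} (hv : v ∉ Λ) :
    childFactor β γ T r Λ σ v =
      edgeFactor β γ (∏ c : {c // IsChild T r v c}, childFactor β γ T r Λ σ c) := by
  have h1 := message_one_pos_of_notMem (r := r) hβ0 hγ hT h hv
  rw [prod_childFactor hv, childFactor, edgeFactor]
  have h2 := message_zero_add_mul_message_one_pos (r := r) hβ0 hγ hT h v
  field_simp

theorem marginal_root (hT : T.IsTree) (h : Feasible β γ T Λ σ) :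
    marginal β γ T Λ σ r = message β γ T r Λ σ r 0 /
      (message β γ T r Λ σ r 0 + message β γ T r Λ σ r 1) := by
  have hZ : partitionFunction β γ T ≠ 0 := fun h0 => by
    rw [Feasible, gibbsProb_extending hT r, h0, div_zero] at h
    exact h.false
  rw [marginal, gibbsProb_extending_inter hT, gibbsProb_extending hT r,
    div_div_div_cancel_right₀ hZ]

open Classical in
theorem ratio_root_of_notMem (hβ0 : 0 ≤ β) (hγ : 0 < γ) (hT : T.IsTree)
    (h : Feasible β γ T Λ σ) (hr : r ∉ Λ) :
    ratio β γ T Λ σ r =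
      ENNReal.ofReal (∏ c : {c // IsChild T r r c}, childFactor β γ T r Λ σ c) := by
  have h1 := message_one_pos_of_notMem (r := r) hβ0 hγ hT h hr
  have hp := message_root_pos (r := r) hβ0 hγ.le hT h
  have e : 1 - marginal β γ T Λ σ r = message β γ T r Λ σ r 1 /
      (message β γ T r Λ σ r 0 + message β γ T r Λ σ r 1) := by
    rw [marginal_root hT h]; field_simp; ring
  rw [ratio, e, ← ENNReal.ofReal_div_of_pos (by positivity), marginal_root hT h,
    div_div_div_cancel_right₀ hp.ne', prod_childFactor hr]

/-- The ratio at a pinned root is `∞` or `0`, according to its spin. -/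
theorem ratio_root_congr (hβ0 : 0 ≤ β) (hγ : 0 < γ) (hT : T.IsTree)
    (hσ : Feasible β γ T Λ σ) (hτ : Feasible β γ T Λ τ) (hr : r ∈ Λ)
    (h : σ ⟨r, hr⟩ = τ ⟨r, hr⟩) : ratio β γ T Λ σ r = ratio β γ T Λ τ r := by
  have pσ := message_root_pos (r := r) hβ0 hγ.le hT hσ
  have pτ := message_root_pos (r := r) hβ0 hγ.le hT hτ
  have e : marginal β γ T Λ σ r = marginal β γ T Λ τ r := by
    rw [marginal_root hT hσ, marginal_root hT hτ]
    rcases (by omega : σ ⟨r, hr⟩ = 0 ∨ σ ⟨r, hr⟩ = 1) with h0 | h0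
    · have e1 : message β γ T r Λ σ r 1 = 0 := message_eq_zero_of_ne hr (by rw [h0]; decide)
      have e2 : message β γ T r Λ τ r 1 = 0 := message_eq_zero_of_ne hr (by rw [← h, h0]; decide)
      rw [e1, add_zero] at pσ ⊢
      rw [e2, add_zero] at pτ ⊢
      rw [div_self pσ.ne', div_self pτ.ne']
    · have e1 : message β γ T r Λ σ r 0 = 0 := message_eq_zero_of_ne hr (by rw [h0]; decide)
      have e2 : message β γ T r Λ τ r 0 = 0 := message_eq_zero_of_ne hr (by rw [← h, h0]; decide)
      rw [e1, e2, zero_div, zero_div]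
  rw [ratio, ratio, e]

end Messages

theorem absDiff_ofReal_le {x y : ℝ} (hx : 0 ≤ x) (hy : 0 ≤ y) :
    absDiff (ENNReal.ofReal x) (ENNReal.ofReal y) ≤ ENNReal.ofReal |x - y| := by
  rw [absDiff, ← ENNReal.ofReal_sub _ hy, ← ENNReal.ofReal_sub _ hx]
  refine max_le (ENNReal.ofReal_le_ofReal (le_abs_self _)) (ENNReal.ofReal_le_ofReal ?_)
  rw [abs_sub_comm]
  exact le_abs_self _

/-! ### Correlation decay -/

theorem clog_two_succ_le (n : ℕ) : Nat.clog 2 (n + 1) ≤ n :=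
  Nat.clog_le_of_le_pow (Nat.succ_le_of_lt n.lt_two_pow_self)

section Decay

variable {V : Type*} [Fintype V] {T : SimpleGraph V} {r : V} {β γ : ℝ} {Λ : Set V}
  {σ τ : Λ → Fin 2}

open Classical in
theorem prod_childFactor_mem_Icc (hβ0 : 0 ≤ β) (hβγ : β * γ < 1) (hγ : 1 < γ) (hT : T.IsTree)
    (h : Feasible β γ T Λ σ) (v : V) :
    ∏ c : {c // IsChild T r v c}, childFactor β γ T r Λ σ c ∈ Set.Icc (0 : ℝ) 1 :=
  ⟨Finset.prod_nonneg fun c _ => childFactor_nonneg hβ0 (by linarith) c.1,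
    Finset.prod_le_one (fun c _ => childFactor_nonneg hβ0 (by linarith) c.1) fun c _ =>
      (childFactor_le hβ0 hβγ (by linarith) hT h c.1).trans (inv_le_one_of_one_le₀ hγ.le)⟩

open Classical in
/-- With base `2`, a step from a vertex with `d` children costs depth `⌈log₂ (d + 1)⌉ ≤ d`, which
the contraction rate `exp (-c d)` pays for. -/
theorem logLogClose_childFactor {c : ℝ} (hβ0 : 0 ≤ β) (hβγ : β * γ < 1) (hγ : 1 < γ)
    (hc0 : 0 < c)
    (hc : ∀ (n : ℕ) (u : ℝ), 0 < u → n * Real.log γ ≤ u →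
      (1 - β * γ) * (Real.exp (-u) * u) ≤ Real.exp (-(c * n)) *
        ((β * Real.exp (-u) + 1) * (Real.exp (-u) + γ) * logFactor β γ u))
    (hT : T.IsTree) (hσ : Feasible β γ T Λ σ) (hτ : Feasible β γ T Λ τ) {L : ℕ}
    (hL : mClosedBall T r 2 L ∩ differenceSet Λ σ τ = ∅) {v : V}
    (hv : v ∈ mClosedBall T r 2 L) :
    LogLogClose ((Real.log (Real.log (1 + γ)) - Real.log (Real.log γ)) *
        Real.exp (-(c * (L - mDepth T r 2 v))))
      (childFactor β γ T r Λ σ v) (childFactor β γ T r Λ τ v) := by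
  have hγ0 : 0 < γ := by linarith
  set K := Real.log (Real.log (1 + γ)) - Real.log (Real.log γ) with hKdef
  have hK : 0 ≤ K := sub_nonneg.2 (Real.log_le_log (Real.log_pos hγ)
    (Real.log_le_log hγ0 (by linarith)))
  induction v using induction_children (T := T) (r := r) with
  | h v ih =>
    by_cases hvΛ : v ∈ Λ
    · refine Or.inl (childFactor_congr hβ0 hγ0 hT hσ hτ hvΛ ?_)
      by_contra hne
      exact Set.eq_empty_iff_forall_notMem.1 hL v ⟨hv, hvΛ, hne⟩
    rw [childFactor_eq_edgeFactor hβ0 hγ0 hT hσ hvΛ, childFactor_eq_edgeFactor hβ0 hγ0 hT hτ hvΛ]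
    rcases le_or_gt (mDepth T r 2 v) L with hd | hd
    · set n := Fintype.card {c // IsChild T r v c} with hn
      have hclose : ∀ u : {u // IsChild T r v u},
          LogLogClose (K * Real.exp (-(c * (L - (mDepth T r 2 v + n)))))
            (childFactor β γ T r Λ σ u) (childFactor β γ T r Λ τ u) := fun u => by
        refine (ih u.1 u.2 (Or.inr ⟨v, hd, u.2⟩)).mono ?_
        rw [mDepth_child hT 2 u.2, numChildren_eq_card, ← hn]
        have := clog_two_succ_le n
        have hcn : c * (Nat.clog 2 (n + 1) : ℝ) ≤ c * n :=
          mul_le_mul_of_nonneg_left (by exact_mod_cast this) hc0.le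
        refine mul_le_mul_of_nonneg_left (Real.exp_le_exp.2 ?_) hK
        rw [Nat.cast_add]
        linarith
      have hstep := logLogClose_edgeFactor_prod hβ0 hβγ hγ hc
        (fun u : {u // IsChild T r v u} => childFactor β γ T r Λ σ u)
        (fun u : {u // IsChild T r v u} => childFactor β γ T r Λ τ u)
        (fun u => childFactor_nonneg hβ0 hγ0.le u.1)
        (fun u => childFactor_le hβ0 hβγ hγ0 hT hσ u.1)
        (fun u => childFactor_le hβ0 hβγ hγ0 hT hτ u.1) hclose
      refine hstep.mono (le_of_eq ?_)
      rw [← hn, mul_left_comm, ← Real.exp_add]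
      ring_nf
    · obtain ⟨a1, a2⟩ := prod_childFactor_mem_Icc (r := r) hβ0 hβγ hγ hT hσ v
      obtain ⟨b1, b2⟩ := prod_childFactor_mem_Icc (r := r) hβ0 hβγ hγ hT hτ v
      refine (logLogClose_edgeFactor hβ0 hβγ hγ a1 a2 b1 b2).mono
        (le_mul_of_one_le_right hK (Real.one_le_exp ?_))
      have : (L : ℝ) ≤ mDepth T r 2 v := by exact_mod_cast hd.le
      nlinarith

open Classical in
theorem prod_childFactor_le_inv (hβ0 : 0 ≤ β) (hβγ : β * γ < 1) (hγ : 1 < γ) (hT : T.IsTree)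
    (h : Feasible β γ T Λ σ) (v : V) [Nonempty {c // IsChild T r v c}] :
    ∏ c : {c // IsChild T r v c}, childFactor β γ T r Λ σ c ≤ γ⁻¹ := by
  obtain ⟨c⟩ := ‹Nonempty {c // IsChild T r v c}›
  have h0 : ∀ c, 0 ≤ childFactor β γ T r Λ σ c := childFactor_nonneg hβ0 (by linarith)
  have hle := childFactor_le (r := r) hβ0 hβγ (by linarith) hT h
  rw [← Finset.mul_prod_erase Finset.univ _ (Finset.mem_univ c)]
  refine (mul_le_of_le_one_right (h0 c) ?_).trans (hle c)
  exact Finset.prod_le_one (fun c _ => h0 c) fun c _ => (hle c).trans (inv_le_one_of_one_le₀ hγ.le)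

end Decay

end TwoSpin

theorem theorem1 (β γ : ℝ) (hβ0 : 0 ≤ β) (hβ1 : β < 1) (hβγ : β * γ < 1)
    (hγ : TwoSpin.uniquenessThreshold β < γ) :
    ∃ M : ℕ, 2 ≤ M ∧ ∃ c : ℝ, 0 < c ∧
      ∀ (V : Type*) [Fintype V] (T : SimpleGraph V) (r : V), T.IsTree →
        ∀ (Λ : Set V) (σ τ : Λ → Fin 2),
          TwoSpin.Feasible β γ T Λ σ → TwoSpin.Feasible β γ T Λ τ →
          ∀ L : ℕ, TwoSpin.mClosedBall T r M L ∩ TwoSpin.differenceSet Λ σ τ = ∅ →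
            TwoSpin.absDiff (TwoSpin.ratio β γ T Λ σ r) (TwoSpin.ratio β γ T Λ τ r)
              ≤ ENNReal.ofReal (Real.exp (-(c * L))) := by
  classical
  obtain ⟨h1, -⟩ := TwoSpin.exists_contraction_bound hβ0 hβ1 hγ
  have hγ0 : 0 < γ := by linarith
  obtain ⟨a, ha, hrate⟩ := TwoSpin.exists_contraction_rate hβ0 hβ1 hβγ hγ
  -- The ratio of a free root with children is at most `1 / γ`; this absorbs the constant of the
  -- exponential decay.
  obtain ⟨c, hc, hdecay⟩ := TwoSpin.exists_exp_decay (ρ := γ⁻¹)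
    (C := (1 + γ) ^ 2 / (1 - β * γ) * Real.log (1 + γ) *
      (Real.log (Real.log (1 + γ)) - Real.log (Real.log γ)))
    (inv_pos.2 hγ0) (inv_lt_one_of_one_lt₀ h1) ha
  refine ⟨2, le_rfl, c, hc, fun V _ T r hT Λ σ τ hσ hτ L hL => ?_⟩
  have hr0 : r ∈ TwoSpin.mClosedBall T r 2 L := Or.inl (by
    rw [TwoSpin.mBall, Set.mem_ofPred_eq, TwoSpin.mDepth_root]; exact Nat.zero_le L)
  by_cases hr : r ∈ Λ
  · rw [TwoSpin.ratio_root_congr hβ0 hγ0 hT hσ hτ hr (by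
      by_contra hne
      exact Set.eq_empty_iff_forall_notMem.1 hL r ⟨hr0, hr, hne⟩)]
    simp [TwoSpin.absDiff]
  rw [TwoSpin.ratio_root_of_notMem hβ0 hγ0 hT hσ hr, TwoSpin.ratio_root_of_notMem hβ0 hγ0 hT hτ hr]
  obtain ⟨a1, a2⟩ := TwoSpin.prod_childFactor_mem_Icc (r := r) hβ0 hβγ h1 hT hσ r
  obtain ⟨b1, b2⟩ := TwoSpin.prod_childFactor_mem_Icc (r := r) hβ0 hβγ h1 hT hτ r
  refine (TwoSpin.absDiff_ofReal_le a1 b1).trans (ENNReal.ofReal_le_ofReal ?_)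
  rcases isEmpty_or_nonempty {u // TwoSpin.IsChild T r r u} with hE | hE
  · simpa using (Real.exp_pos _).le
  refine le_trans (le_min ?_ ?_) (hdecay L)
  · have := TwoSpin.prod_childFactor_le_inv (T := T) (r := r) hβ0 hβγ h1 hT hσ r
    have := TwoSpin.prod_childFactor_le_inv (T := T) (r := r) hβ0 hβγ h1 hT hτ r
    rw [abs_le]
    constructor <;> linarith
  · have hclose := TwoSpin.logLogClose_childFactor hβ0 hβγ h1 ha hrate hT hσ hτ hL hr0
    rw [TwoSpin.mDepth_root, Nat.cast_zero, sub_zero,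
      TwoSpin.childFactor_eq_edgeFactor hβ0 hγ0 hT hσ hr,
      TwoSpin.childFactor_eq_edgeFactor hβ0 hγ0 hT hτ hr] at hclose
    have hK : 0 ≤ Real.log (Real.log (1 + γ)) - Real.log (Real.log γ) :=
      sub_nonneg.2 (Real.log_le_log (Real.log_pos h1) (Real.log_le_log hγ0 (by linarith)))
    rw [mul_assoc _ (Real.log (Real.log (1 + γ)) - _)]
    exact TwoSpin.abs_sub_le_of_logLogClose hβ0 hβγ h1 a1 a2 b1 b2
      (mul_nonneg hK (Real.exp_pos _).le) hclose
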